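/- Let $n\ge 1$, let $\mu$ be Lebesgue measure on $\mathbb R^n$, let $\operatorname{ci}(A)$ be the closure of the interior of $A$, and let $\mathfrak J_n$ be the collection of all bounded sets $A\subset\mathbb R^n$ with $A=\operatorname{ci}(A)$ and $\mu(\partial A)=0$ (so $\emptyset\in\mathfrak J_n$). Fix real numbers $N\ge 1$ and $\varepsilon>0$. **The measure average.** For a nonempty $A$ put $d_S(p,A)=d(p,\partial A)$ if $p\in A$ and $d_S(p,A)=-d(p,\partial A)$ if $p\notin A$. The measure average $tA\oplus(1-t)B\in\mathfrak J_n$ of $A,B\in\mathfrak J_n$ with $t\in[0,1]$ is defined in three steps. 1. Let $B\subsetneq A$. For $x\in\mathbb R$ let $f_x(p)=x\,d_S(p,A)+(1-x)\,d_S(p,B)$, where for $B=\emptyset$ one replaces $d_S(p,B)$ by $-\|p-q\|$, with $q$ any point of $A$ at which $d_S(\cdot,A)$ attains its supremum over $A$. Let $h(x)=\mu(\{f_x\ge 0\})$ and $m=t\mu(A)+(1-t)\mu(B)$. If $\mu(\{f_{1/2}=0\})=0$, the *simple average* of $A,B$ with parameter $t$ is $\operatorname{ci}(\{f_g\ge 0\})$,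 where $g$ is any minimizer of $|h-m|$ on $[-N,N]$. Otherwise it is $\operatorname{ci}(A\cap\{p:d(p,B)\le r\})$, where $r\ge 0$ is any number with $\mu(A\cap\{p:d(p,B)\le r\})=m$. 2. Let $B\subseteq A$. If $A=B$, then $tA\oplus(1-t)A=A$. Otherwise $tA\oplus(1-t)B=\bigcup_P R_P$, where $P$ runs over the connected components of $A\setminus B$ if there are finitely many of them, and otherwise over the components of measure at least $\varepsilon$ together with the union of all components of measure less than $\varepsilon$; here $R_P$ is the simple average of $\operatorname{ci}(B\cup P)$ and $B$ with parameter $t$. 3. For general $A,B$, $\;tA\oplus(1-t)B=\bigl(tA\oplus(1-t)D\bigr)\cup\bigl((1-t)B\oplus tD\bigr)$ with $D=\operatorname{ci}(A\cap B)$. **Corollary 5.4.** Let $S(\{f_i\}_{i\in\mathbb Z})=\sum_i a_if_i$ be an averaging rule for sequences $\{f_i\}_{i\in\mathbb Z}\subset\mathbb R$, with $a_i\ge 0$ and $\sum_i a_i=1$, and suppose that $S$ is represented, for all sequences of real numbers, by finitely many repeated binary averages $tu+(1-t)v$ with $t\in[0,1]$ (so only finitely many $a_i$ are nonzero). Let $S^*$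 be the adaptation of $S$ to sets obtained by replacing each binary average of numbers in this representation by the measure average of sets. Then for every sequence $\{F_i\}_{i\in\mathbb Z}\subset\mathfrak J_n$ the set $S^*(\{F_i\}_{i\in\mathbb Z})$ exists and, whatever admissible choices of $q,g,r$ are made, it belongs to $\mathfrak J_n$ and $$\mu\bigl(S^*(\{F_i\}_{i\in\mathbb Z})\bigr)=\sum_i a_i\,\mu(F_i)=S\bigl(\{\mu(F_i)\}_{i\in\mathbb Z}\bigr).$$ -/

import Mathlib

open MeasureTheory

namespace SetAverage

/-- `n`-dimensional Euclidean space. -/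
abbrev Space (n : ℕ) : Type := EuclideanSpace ℝ (Fin n)

/-- `ci A`, the closure of the interior of `A`. -/
def ci {n : ℕ} (A : Set (Space n)) : Set (Space n) := closure (interior A)

/-- The regular compact Jordan measurable subsets of `ℝⁿ` (the empty set is one of them). -/
def RegularJordan (n : ℕ) : Set (Set (Space n)) :=
  {A | Bornology.IsBounded A ∧ A = ci A ∧ volume (frontier A) = 0}

open Classical in
/-- The signed distance `d_S(p, A)` of `p` from a nonempty set `A`: the distance from `p` to the
boundary of `A`, with sign `+` for `p ∈ A` and sign `-` for `p ∉ A`. -/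
noncomputable def sgnDist {n : ℕ} (A : Set (Space n)) (p : Space n) : ℝ :=
  if p ∈ A then Metric.infDist p (frontier A) else -Metric.infDist p (frontier A)

/-- `q` is a center point of `A`: a point of `A` at which the signed distance function of `A`
attains its supremum over `A`. -/
def IsCenter {n : ℕ} (A : Set (Space n)) (q : Space n) : Prop :=
  q ∈ A ∧ ∀ a ∈ A, sgnDist A a ≤ sgnDist A q

open Classical in
/-- The function `x d_S(p, A) + (1 - x) d_S(p, B)`, for nonempty `A`. If `B` is empty, then
`d_S(p, B)` is replaced by `-‖p - q‖`, where `q` stands for a center point of `A`;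
for nonempty `B` the point `q` plays no role. -/
noncomputable def levelFun {n : ℕ} (A B : Set (Space n)) (q : Space n) (x : ℝ) (p : Space n) : ℝ :=
  x * sgnDist A p + (1 - x) * (if B.Nonempty then sgnDist B p else -dist p q)

/-- The distance average of `A` and `B` with averaging parameter `x`. -/
def distanceAverage {n : ℕ} (A B : Set (Space n)) (q : Space n) (x : ℝ) : Set (Space n) :=
  {p | 0 ≤ levelFun A B q x p}

/-- The zero-measure condition. -/
def ZeroMeasureCondition {n : ℕ} (A B : Set (Space n)) (q : Space n) : Prop :=
  volume {p | levelFun A B q (1 / 2) p = 0} = 0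

/-- `M` is the measure average `t A ⊕ (1 - t) B`, `t ∈ [0, 1]`, of two sets `B ⊂ A` whose
difference is treated as a single component; `N` bounds the parameters of the distance average.

If the zero-measure condition holds, then `M` is `ci` of a distance average, whose parameter `g`
minimizes over `[-N, N]` the deviation of the measure from the average of the measures.
Otherwise `M` is `ci` of the intersection of `A` with an offset
`{p | d(p, B) ≤ r}` of `B`, `r ≥ 0`, that has the average of the measures as its measure. -/
def IsSimpleAverage {n : ℕ} (N t : ℝ) (A B M : Set (Space n)) : Prop :=
  ∃ q, IsCenter A q ∧
    ((ZeroMeasureCondition A B q ∧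
        ∃ g ∈ Set.Icc (-N) N,
          IsMinOn (fun ξ : ℝ => |volume.real (distanceAverage A B q ξ)
              - (t * volume.real A + (1 - t) * volume.real B)|) (Set.Icc (-N) N) g ∧
          M = ci (distanceAverage A B q g)) ∨
      (¬ ZeroMeasureCondition A B q ∧
        ∃ r : ℝ, 0 ≤ r ∧
          volume.real (Metric.cthickening r B ∩ A)
            = t * volume.real A + (1 - t) * volume.real B ∧
          M = ci (Metric.cthickening r B ∩ A)))

/-- The collection of all connected components of `D`. -/
def components {n : ℕ} (D : Set (Space n)) : Set (Set (Space n)) :=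
  {C | ∃ p ∈ D, C = connectedComponentIn D p}

open Classical in
/-- The pieces into which `A \ B` is decomposed: its connected components if there are finitely
many of them; otherwise the components of measure at least `ε`, and one more piece, the union of
all components of measure smaller than `ε`. -/
noncomputable def pieces {n : ℕ} (ε : ℝ) (A B : Set (Space n)) : Set (Set (Space n)) :=
  if (components (A \ B)).Finite then components (A \ B)
  else insert (⋃₀ {C ∈ components (A \ B) | volume.real C < ε})
    {C ∈ components (A \ B) | ε ≤ volume.real C}

/-- `M` is the measure average `t A ⊕ (1 - t) B`, `t ∈ [0, 1]`, of two sets `B ⊆ A`: it is `A` if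
`A = B`, and otherwise the union over the pieces `P` of `A \ B` of the averages
`t (B ∪ P) ⊕ (1 - t) B`. The operation `ci` in `ci (B ∪ P)` changes nothing when `B ∪ P` is regular
compact, as it is when `A \ B` has finitely many components; for infinitely many components it
keeps the operand regular compact. -/
def IsNestedAverage {n : ℕ} (N ε t : ℝ) (A B M : Set (Space n)) : Prop :=
  (A = B ∧ M = A) ∨
    (B ⊂ A ∧ ∃ R : Set (Space n) → Set (Space n),
      (∀ P ∈ pieces ε A B, IsSimpleAverage N t (ci (B ∪ P)) B (R P)) ∧
      M = ⋃ P ∈ pieces ε A B, R P)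

/-- `M` is the measure average `t A ⊕ (1 - t) B`, `t ∈ [0, 1]`, of two general sets. -/
def IsMeasureAverage {n : ℕ} (N ε t : ℝ) (A B M : Set (Space n)) : Prop :=
  ∃ R₁ R₂, IsNestedAverage N ε t A (ci (A ∩ B)) R₁ ∧
    IsNestedAverage N ε (1 - t) B (ci (A ∩ B)) R₂ ∧ M = R₁ ∪ R₂

/-- Repeated binary averages with nonnegative averaging parameters `t` and `1 - t`, applied to the
terms of a sequence indexed by `ℤ`. -/
inductive BinaryScheme : Type where
  | term (i : ℤ) : BinaryScheme
  | average (t : Set.Icc (0 : ℝ) 1) (l r : BinaryScheme) : BinaryScheme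

/-- The result of the repeated binary averages on a sequence of numbers. -/
noncomputable def BinaryScheme.onReals (f : ℤ → ℝ) : BinaryScheme → ℝ
  | .term i => f i
  | .average t l r => (t : ℝ) * l.onReals f + (1 - (t : ℝ)) * r.onReals f

/-- `T.OnSets N ε F M`: the set `M` results from the sequence of sets `F` when every average of
numbers in `T` is replaced by the measure average of sets. -/
def BinaryScheme.OnSets {n : ℕ} (N ε : ℝ) (F : ℤ → Set (Space n)) :
    BinaryScheme → Set (Space n) → Prop
  | .term i, M => M = F i
  | .average t l r, M => ∃ A B, l.OnSets N ε F A ∧ r.OnSets N ε F B ∧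
      IsMeasureAverage N ε (t : ℝ) A B M

/-- The weights `a` define the averaging rule `f ↦ ∑ i, a i * f i`. -/
def IsAveragingRule (a : ℤ → ℝ) : Prop := (∀ i, 0 ≤ a i) ∧ HasSum a 1

/-- The averaging rule with weights `a` is represented by the repeated binary averages `T`. (As `f`
is arbitrary, only finitely many weights can be nonzero.) -/
def BinaryScheme.Represents (T : BinaryScheme) (a : ℤ → ℝ) : Prop :=
  ∀ f : ℤ → ℝ, HasSum (fun i => a i * f i) (T.onReals f)

end SetAverage

/-! Each averaging operation has the right measure and yields a regular Jordan set, so the claim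
follows by induction on the binary scheme. The invariant for `B ⊆ A` is `IsIntermediate`: the
average lies between `B` and `A`, has null boundary, equals its own `ci`, and has measure `t μ(A) +
(1 - t) μ(B)`.

For simple averages the measure is reached by the intermediate value theorem, which needs null level
sets. Zero sets of combinations of distance functions are porous, hence null by Lebesgue density
(`volume_eq_zero_of_steep`), unless the two coefficients balance. Balance occurs only at parameter
`1/2`, which the zero-measure condition covers; for offsets the level sets `d(p, B) = r > 0` are
always null.

The pieces of `A \ B` are finite in number, disjoint, and have null boundary, so their contributions
`t μ(P)` add up (`IsIntermediate.biUnion`). For general sets, the two nested averages meet in `D =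
ci (A ∩ B)` up to a null set, and inclusion-exclusion gives the measure (`IsMeasureAverage.spec`).
-/

open Filter Topology

namespace SetAverage

/-! ### Null zero sets via porosity and Lebesgue density. -/

/-- A Lipschitz function vanishing on `s` whose values, arbitrarily close to each point of `s`, are
at least proportional to the distance from that point forces `s` to be porous, hence null. -/
theorem volume_eq_zero_of_steep {n : ℕ} {f : Space n → ℝ} {K : NNReal} (hf : LipschitzWith K f)
    {s : Set (Space n)} (hs : MeasurableSet s) (hs0 : ∀ p ∈ s, f p = 0)
    (h : ∀ p ∈ s, ∃ κ > 0, ∃ δ > 0, ∀ r, 0 < r → r < δ → ∃ p', dist p' p ≤ r ∧ κ * r ≤ |f p'|) :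
    volume s = 0 := by
  have key := Besicovitch.ae_tendsto_measure_inter_div (volume : Measure (Space n)) s
  rw [ae_restrict_iff' hs] at key
  have hall : ∀ᵐ x ∂(volume : Measure (Space n)), x ∉ s := by
    filter_upwards [key] with x hx hxs
    have ht := hx hxs
    obtain ⟨κ, hκ, δ, hδ, hst⟩ := h x hxs
    have hK : (0 : ℝ) ≤ K := K.2
    -- The ball of radius `η R` about `p'` must stay in the ball of radius `R` about `x` (hence `η ≤
    -- 1/2`) and miss `s` (hence `η K < κ / 2`). It takes the fixed fraction `c` of the volume, so
    -- `x` is not a density point.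
    set η : ℝ := min (κ / (2 * (K + 1))) (1 / 2) with hη
    have hη0 : 0 < η := by positivity
    have hη1 : η ≤ 1 / 2 := min_le_right _ _
    have hη2 : η * (K + 1) ≤ κ / 2 := by
      have : η ≤ κ / (2 * (K + 1)) := min_le_left _ _
      rw [le_div_iff₀ (by positivity)] at this
      linarith
    set c : ENNReal := ENNReal.ofReal (η ^ Module.finrank ℝ (Space n)) with hc
    have hc0 : c ≠ 0 := by
      rw [hc, Ne, ENNReal.ofReal_eq_zero, not_le]; positivity
    have hev : ∀ᶠ r in 𝓝[>] (0 : ℝ),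
        volume (s ∩ Metric.closedBall x r) / volume (Metric.closedBall x r) + c ≤ 1 := by
      filter_upwards [Ioo_mem_nhdsGT hδ] with R hR
      obtain ⟨p', hp', hfp⟩ := hst (R / 2) (by linarith [hR.1]) (by linarith [hR.1, hR.2])
      have hR0 := hR.1
      have hdisj : Disjoint (s ∩ Metric.closedBall x R) (Metric.ball p' (η * R)) := by
        rw [Set.disjoint_left]
        rintro z ⟨hzs, -⟩ hz
        have h1 := hf.dist_le_mul p' z
        rw [hs0 z hzs, Real.dist_eq, sub_zero] at h1
        rw [Metric.mem_ball, dist_comm] at hz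
        have h2 : (K : ℝ) * dist p' z ≤ K * (η * R) := by gcongr
        have h3 : η * (K + 1) * R ≤ κ / 2 * R := by gcongr
        have h4 : 0 < η * R := by positivity
        nlinarith
      have hsub : Metric.ball p' (η * R) ⊆ Metric.closedBall x R := by
        intro z hz
        rw [Metric.mem_ball] at hz
        rw [Metric.mem_closedBall]
        have := dist_triangle z p' x
        nlinarith
      have hvol : volume (Metric.ball p' (η * R)) = c * volume (Metric.closedBall x R) := by
        rw [Measure.addHaar_ball_of_pos _ _ (by positivity), Measure.addHaar_closedBall _ _ hR0.le, hc,
          mul_pow, ENNReal.ofReal_mul (by positivity), mul_assoc]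
      have hle : volume (s ∩ Metric.closedBall x R) + c * volume (Metric.closedBall x R)
          ≤ volume (Metric.closedBall x R) := by
        rw [← hvol, ← measure_union hdisj Metric.isOpen_ball.measurableSet]
        exact measure_mono (Set.union_subset Set.inter_subset_right hsub)
      have hb0 : volume (Metric.closedBall x R) ≠ 0 :=
        (Metric.measure_closedBall_pos _ _ hR0).ne'
      have hbt : volume (Metric.closedBall x R) ≠ ⊤ := measure_closedBall_lt_top.ne
      calc _ = (volume (s ∩ Metric.closedBall x R) + c * volume (Metric.closedBall x R))
            / volume (Metric.closedBall x R) := by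
            rw [ENNReal.add_div, ENNReal.mul_div_cancel_right hb0 hbt]
        _ ≤ 1 := ENNReal.div_le_of_le_mul (by simpa using hle)
    have := le_of_tendsto (ht.add_const c) hev
    have h1 : (1 : ENNReal) + c ≤ 1 + 0 := by simpa using this
    exact hc0 (le_antisymm ((ENNReal.add_le_add_iff_left ENNReal.one_ne_top).1 h1) bot_le)
  simpa [ae_iff] using hall

/-- A function that is, up to sign, the distance to its zero set. -/
structure IsDistLike {n : ℕ} (u : Space n → ℝ) : Prop where
  lipschitz : LipschitzWith 1 u
  exists_zero : ∀ p, ∃ y, u y = 0 ∧ dist p y = |u p|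

theorem exists_dist_eq_of_le {n : ℕ} (p y : Space n) {s : ℝ} (hs : 0 ≤ s) (hsy : s ≤ dist p y) :
    ∃ p', dist p' p = s ∧ dist p' y = dist p y - s := by
  rcases eq_or_ne p y with rfl | hne
  · refine ⟨p, ?_⟩
    simp at hsy ⊢
    constructor <;> linarith
  have hd : 0 < dist p y := dist_pos.2 hne
  refine ⟨AffineMap.lineMap p y (s / dist p y), ?_, ?_⟩
  · rw [dist_lineMap_left, Real.norm_of_nonneg (by positivity)]
    field_simp
  · rw [dist_lineMap_right, Real.norm_of_nonneg]
    · field_simp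
    · rw [sub_nonneg, div_le_one hd]; exact hsy

/-- Moving straight towards a nearest zero decreases `|u|` at unit rate, since `u` is 1-Lipschitz
and vanishes there. -/
theorem IsDistLike.exists_steep {n : ℕ} {u : Space n → ℝ} (hu : IsDistLike u) (p : Space n)
    {s : ℝ} (hs : 0 ≤ s) (hsu : s ≤ |u p|) : ∃ p', dist p' p = s ∧ s ≤ |u p' - u p| := by
  obtain ⟨y, hy, hd⟩ := hu.exists_zero p
  obtain ⟨p', h1, h2⟩ := exists_dist_eq_of_le p y hs (hd ▸ hsu)
  refine ⟨p', h1, ?_⟩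
  have h3 := hu.lipschitz.dist_le_mul p' y
  rw [hy, Real.dist_eq, sub_zero, h2, hd, NNReal.coe_one, one_mul] at h3
  have h4 := abs_sub_abs_le_abs_sub (u p) (u p')
  rw [abs_sub_comm] at h4
  linarith

/-- The zero set of a combination of two such functions is null where the dominating one does not
vanish. -/
theorem IsDistLike.volume_zeros {n : ℕ} {u v : Space n → ℝ} (hu : IsDistLike u)
    (hv : LipschitzWith 1 v) {α β : ℝ} (hαβ : |β| < |α|) :
    volume {p | α * u p + β * v p = 0 ∧ u p ≠ 0} = 0 := by
  have hf : LipschitzWith (‖α‖₊ * 1 + ‖β‖₊ * 1) fun p => α * u p + β * v p :=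
    ((lipschitzWith_smul α).comp hu.lipschitz).add ((lipschitzWith_smul β).comp hv)
  have hcu := hu.lipschitz.continuous
  refine volume_eq_zero_of_steep hf ?_ (fun p hp => hp.1) ?_
  · exact (measurableSet_eq_fun hf.continuous.measurable measurable_const).inter
      (measurableSet_eq_fun hcu.measurable measurable_const).compl
  rintro p ⟨hp, hup⟩
  -- Over a suitable step of length `r`, `α u` changes by at least `|α| r` and `β v` by at most `|β|
  -- r`.
  refine ⟨|α| - |β|, by linarith, |u p|, abs_pos.2 hup, fun r hr hru => ?_⟩
  obtain ⟨p', h1, h2⟩ := hu.exists_steep p hr.le hru.le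
  refine ⟨p', h1.le, ?_⟩
  have h3 := hv.dist_le_mul p' p
  rw [Real.dist_eq, h1, NNReal.coe_one, one_mul] at h3
  have h4 : α * u p' + β * v p' = α * (u p' - u p) - (- (β * (v p' - v p))) := by linarith
  rw [h4]
  have h5 := abs_sub_abs_le_abs_sub (α * (u p' - u p)) (-(β * (v p' - v p)))
  rw [abs_neg, abs_mul, abs_mul] at h5
  have h6 : |α| * r ≤ |α| * |u p' - u p| := by gcongr
  have h7 : |β| * |v p' - v p| ≤ |β| * r := by gcongr
  linarith

theorem isDistLike_neg_dist {n : ℕ} (q : Space n) : IsDistLike fun p => -dist p q :=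
  ⟨(LipschitzWith.dist_left q).neg, fun p => ⟨q, by simp, by simp⟩⟩

theorem isDistLike_infDist {n : ℕ} {B : Set (Space n)} (hB : IsClosed B) (hne : B.Nonempty) :
    IsDistLike fun p => Metric.infDist p B := by
  refine ⟨Metric.lipschitz_infDist_pt B, fun p => ?_⟩
  obtain ⟨y, hy, hd⟩ := hB.exists_infDist_eq_dist hne p
  exact ⟨y, Metric.infDist_zero_of_mem hy, by rw [hd, abs_of_nonneg dist_nonneg]⟩

theorem volume_infDist_eq {n : ℕ} {B : Set (Space n)} (hB : IsClosed B) (hne : B.Nonempty)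
    {r : ℝ} (hr : r ≠ 0) : volume {p | Metric.infDist p B = r} = 0 := by
  -- The constant `r` is written as `(1/2) * (2 r)` to make the second coefficient strictly smaller
  -- than the first.
  have := (isDistLike_infDist hB hne).volume_zeros ((LipschitzWith.const (2 * r)).weaken zero_le_one) (α := 1)
    (β := -(1 / 2)) (by norm_num [abs_of_pos])
  refine measure_mono_null (fun p hp => ?_) this
  simp only [Set.mem_ofPred_eq] at hp ⊢
  rw [hp]
  exact ⟨by ring, hr⟩

/-- The coefficients balance here, so `IsDistLike.volume_zeros` does not apply. Instead, moving from
`p` towards its nearest zero `y` lowers `u` at unit rate, but lowers the distance to `q` only at the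
rate of the cosine of the angle at `p`. That cosine is below 1 because `y` and `q` are distinct and
equidistant from `p`. -/
theorem volume_dist_eq_of_center {n : ℕ} {u : Space n → ℝ} (hu : IsDistLike u) {q : Space n}
    (hq : 0 < u q) : volume {p | u p - dist p q = 0} = 0 := by
  have hd : LipschitzWith (1 + 1) fun p => u p - dist p q :=
    hu.lipschitz.sub (LipschitzWith.dist_left q)
  refine volume_eq_zero_of_steep hd
    (measurableSet_eq_fun hd.continuous.measurable measurable_const) (fun p hp => hp) ?_
  intro p hp
  replace hp : u p = dist p q := by simpa [sub_eq_zero] using hp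
  have hpq : p ≠ q := by
    rintro rfl
    rw [dist_self] at hp
    linarith
  have hρ : 0 < dist p q := dist_pos.2 hpq
  obtain ⟨y, hy, hdy⟩ := hu.exists_zero p
  rw [hp, abs_of_pos hρ] at hdy
  have hyq : y ≠ q := by
    rintro rfl
    linarith
  have hin : inner ℝ (p - y) (p - q) < dist p q * dist p q := by
    have h1 : inner ℝ (p - y) (p - q) ≤ ‖p - y‖ * ‖p - q‖ := real_inner_le_norm _ _
    rw [← dist_eq_norm, ← dist_eq_norm, hdy] at h1
    refine lt_of_le_of_ne h1 fun he => hyq ?_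
    have h2 : ‖(p - y) - (p - q)‖ ^ 2 = 0 := by
      rw [@norm_sub_sq_real, ← dist_eq_norm, ← dist_eq_norm, he, hdy]; ring
    have h3 : (p - y) - (p - q) = 0 := by simpa using h2
    have h4 := sub_eq_zero.1 h3
    simpa using h4
  set ρ := dist p q with hρd
  set c := inner ℝ (p - y) (p - q) with hc
  refine ⟨1 - c / ρ ^ 2, ?_, ρ, hρ, fun s hs hsρ => ?_⟩
  · rw [gt_iff_lt, sub_pos, div_lt_one (by positivity)]; nlinarith
  set p' := p - (s / ρ) • (p - y) with hp'
  have e1 : dist p' p = s := by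
    rw [dist_eq_norm, hp', sub_sub_cancel_left, norm_neg, norm_smul, ← dist_eq_norm, hdy,
      Real.norm_of_nonneg (by positivity)]
    field_simp
  have e2 : dist p' y = ρ - s := by
    have : p' - y = (1 - s / ρ) • (p - y) := by rw [hp', sub_smul, one_smul]; abel
    rw [dist_eq_norm, this, norm_smul, ← dist_eq_norm p y, hdy, Real.norm_of_nonneg]
    · field_simp
    · rw [sub_nonneg, div_le_one hρ]; exact hsρ.le
  -- The distance to `q` is bounded below by projecting onto the direction `p - q`.
  have e3 : ρ - s / ρ ^ 2 * c ≤ dist p' q := by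
    have h1 : inner ℝ (p' - q) (p - q) ≤ ‖p' - q‖ * ‖p - q‖ := real_inner_le_norm _ _
    have h2 : p' - q = (p - q) - (s / ρ) • (p - y) := by rw [hp']; abel
    have h3 : inner ℝ (p' - q) (p - q) = ρ ^ 2 - s / ρ * c := by
      rw [h2, inner_sub_left, real_inner_smul_left, real_inner_self_eq_norm_sq, ← dist_eq_norm]
    rw [h3, ← dist_eq_norm, ← dist_eq_norm] at h1
    rw [← mul_le_mul_iff_of_pos_right hρ]
    refine le_trans (le_of_eq ?_) h1
    field_simp
  have e4 : u p' ≤ ρ - s := by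
    have h3 := hu.lipschitz.dist_le_mul p' y
    rw [hy, Real.dist_eq, sub_zero, e2, NNReal.coe_one, one_mul] at h3
    exact (le_abs_self _).trans h3
  refine ⟨p', e1.le, ?_⟩
  rw [abs_sub_comm]
  refine le_trans ?_ (le_abs_self _)
  have : (1 - c / ρ ^ 2) * s = s - s / ρ ^ 2 * c := by ring
  linarith

/-! ### Signed distance functions. -/

theorem sgnDist_of_mem {n : ℕ} {A : Set (Space n)} (hA : A ≠ Set.univ) {p : Space n}
    (hp : p ∈ A) :
    sgnDist A p = Metric.infDist p Aᶜ ∧ ∃ y ∈ frontier A, dist p y = sgnDist A p := by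
  obtain ⟨y, hy, hd⟩ := exists_mem_frontier_infDist_compl_eq_dist hp hA
  have h : Metric.infDist p (frontier A) = Metric.infDist p Aᶜ := by
    refine le_antisymm (hd ▸ Metric.infDist_le_dist_of_mem hy) ?_
    have h1 : frontier A ⊆ closure Aᶜ := by
      rw [← frontier_compl]; exact frontier_subset_closure
    rw [← Metric.infDist_closure (s := Aᶜ)]
    exact Metric.infDist_le_infDist_of_subset h1 ⟨y, hy⟩
  have h2 : sgnDist A p = Metric.infDist p Aᶜ := by rw [sgnDist, if_pos hp, h]
  exact ⟨h2, y, hy, by rw [h2, hd]⟩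

theorem sgnDist_compl {n : ℕ} (A : Set (Space n)) (p : Space n) :
    sgnDist Aᶜ p = -sgnDist A p := by
  by_cases hp : p ∈ A <;> simp [sgnDist, hp]

theorem sgnDist_of_notMem {n : ℕ} {A : Set (Space n)} (hA : A.Nonempty) {p : Space n}
    (hp : p ∉ A) :
    sgnDist A p = -Metric.infDist p A ∧ ∃ y ∈ frontier A, dist p y = -sgnDist A p := by
  have h := sgnDist_of_mem (A := Aᶜ) (by simpa using hA.ne_empty) hp
  rw [sgnDist_compl, compl_compl, frontier_compl] at h
  exact ⟨by rw [← h.1, neg_neg], h.2⟩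

/-- The signed distance is a difference of distances. -/
theorem sgnDist_eq {n : ℕ} {A : Set (Space n)} (hA : A.Nonempty) (hA' : A ≠ Set.univ)
    (p : Space n) : sgnDist A p = Metric.infDist p Aᶜ - Metric.infDist p A := by
  by_cases hp : p ∈ A
  · rw [(sgnDist_of_mem hA' hp).1, Metric.infDist_zero_of_mem hp, sub_zero]
  · rw [(sgnDist_of_notMem hA hp).1, Metric.infDist_zero_of_mem (Set.mem_compl hp), zero_sub]

theorem sgnDist_mono {n : ℕ} {A B : Set (Space n)} (hB : B.Nonempty) (hA : A ≠ Set.univ)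
    (hBA : B ⊆ A) (p : Space n) : sgnDist B p ≤ sgnDist A p := by
  rw [sgnDist_eq (hB.mono hBA) hA, sgnDist_eq hB (fun h => hA (Set.univ_subset_iff.1 (h ▸ hBA)))]
  exact sub_le_sub
    (Metric.infDist_le_infDist_of_subset (Set.compl_subset_compl.2 hBA)
      (Set.nonempty_compl.2 hA))
    (Metric.infDist_le_infDist_of_subset hBA hB)

/-- The segment from `p` to `q` crosses the frontier, and the crossing point splits its length. This
gives the Lipschitz bound for `sgnDist` across the boundary. -/
theorem infDist_compl_add_infDist_le {n : ℕ} {A : Set (Space n)} {p q : Space n} (hp : p ∈ A)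
    (hq : q ∉ A) : Metric.infDist p Aᶜ + Metric.infDist q A ≤ dist p q := by
  have hconn : IsPreconnected (segment ℝ p q) := (convex_segment p q).isPreconnected
  have : (segment ℝ p q ∩ frontier A).Nonempty := by
    by_contra hne
    have hd : segment ℝ p q ∩ frontier A = ∅ := Set.not_nonempty_iff_eq_empty.1 hne
    have hsub : segment ℝ p q ⊆ interior A ∪ interior Aᶜ := by
      intro z hz
      by_contra hz'
      have : z ∈ frontier A := by
        rw [frontier_eq_inter_compl_interior]
        simp only [Set.mem_union, not_or] at hz'
        exact hz'
      exact Set.notMem_empty z (hd ▸ ⟨hz, this⟩)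
    have hps := left_mem_segment ℝ p q
    have hqs := right_mem_segment ℝ p q
    have hp1 : p ∈ interior A := (hsub hps).resolve_right fun h => interior_subset h hp
    have hq1 : q ∈ interior Aᶜ := (hsub hqs).resolve_left fun h => hq (interior_subset h)
    obtain ⟨z, -, h1, h2⟩ :=
      hconn _ _ isOpen_interior isOpen_interior hsub ⟨p, hps, hp1⟩ ⟨q, hqs, hq1⟩
    exact interior_subset h2 (interior_subset h1)
  obtain ⟨z, hz, hzf⟩ := this
  have hz1 : z ∈ closure A := frontier_subset_closure hzf
  have hz2 : z ∈ closure Aᶜ := frontier_subset_closure (frontier_compl A ▸ hzf)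
  rw [← Metric.infDist_closure (s := Aᶜ), ← Metric.infDist_closure (s := A),
    ← dist_add_dist_of_mem_segment hz, dist_comm z q]
  exact add_le_add (Metric.infDist_le_dist_of_mem hz2) (Metric.infDist_le_dist_of_mem hz1)

theorem isDistLike_sgnDist {n : ℕ} {A : Set (Space n)} (hA : A.Nonempty) (hA' : A ≠ Set.univ) :
    IsDistLike (sgnDist A) := by
  have hzero : ∀ y ∈ frontier A, sgnDist A y = 0 := by
    intro y hy
    simp [sgnDist, Metric.infDist_zero_of_mem hy]
  refine ⟨LipschitzWith.of_le_add fun p q => ?_, fun p => ?_⟩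
  · by_cases hp : p ∈ A <;> by_cases hq : q ∈ A
    · rw [(sgnDist_of_mem hA' hp).1, (sgnDist_of_mem hA' hq).1]
      exact Metric.infDist_le_infDist_add_dist
    · rw [(sgnDist_of_mem hA' hp).1, (sgnDist_of_notMem hA hq).1]
      linarith [infDist_compl_add_infDist_le hp hq]
    · rw [(sgnDist_of_notMem hA hp).1, (sgnDist_of_mem hA' hq).1]
      have h1 : 0 ≤ Metric.infDist p A := Metric.infDist_nonneg
      have h2 : 0 ≤ Metric.infDist q Aᶜ := Metric.infDist_nonneg
      have h3 : 0 ≤ dist p q := dist_nonneg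
      linarith
    · rw [(sgnDist_of_notMem hA hp).1, (sgnDist_of_notMem hA hq).1]
      have : Metric.infDist q A ≤ Metric.infDist p A + dist q p :=
        Metric.infDist_le_infDist_add_dist
      rw [dist_comm q p] at this
      linarith
  · by_cases hp : p ∈ A
    · obtain ⟨h, y, hy, hd⟩ := sgnDist_of_mem hA' hp
      refine ⟨y, hzero y hy, ?_⟩
      rw [hd, abs_of_nonneg (h ▸ Metric.infDist_nonneg)]
    · obtain ⟨h, y, hy, hd⟩ := sgnDist_of_notMem hA hp
      refine ⟨y, hzero y hy, ?_⟩
      rw [hd, abs_of_nonpos]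
      rw [h, neg_nonpos]
      exact Metric.infDist_nonneg

theorem sgnDist_neg {n : ℕ} {A : Set (Space n)} (hA : A.Nonempty) (hc : IsClosed A)
    {p : Space n} (hp : p ∉ A) : sgnDist A p < 0 := by
  rw [(sgnDist_of_notMem hA hp).1, neg_lt_zero]
  exact (hc.notMem_iff_infDist_pos hA).1 hp

theorem sgnDist_nonneg_iff {n : ℕ} {A : Set (Space n)} (hA : A.Nonempty) (hc : IsClosed A)
    {p : Space n} : 0 ≤ sgnDist A p ↔ p ∈ A := by
  refine ⟨fun h => by_contra fun hp => absurd (sgnDist_neg hA hc hp) h.not_gt, fun hp => ?_⟩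
  rw [sgnDist, if_pos hp]
  exact Metric.infDist_nonneg

theorem sgnDist_pos {n : ℕ} {A : Set (Space n)} (hA' : A ≠ Set.univ) {p : Space n}
    (hp : p ∈ interior A) : 0 < sgnDist A p := by
  rw [(sgnDist_of_mem hA' (interior_subset hp)).1, ← Metric.infDist_closure,
    ← isClosed_closure.notMem_iff_infDist_pos (Set.nonempty_compl.2 hA').closure, closure_compl]
  exact fun h => h hp

theorem mem_frontier_of_sgnDist_eq_zero {n : ℕ} {A : Set (Space n)} (hA : A.Nonempty)
    (hA' : A ≠ Set.univ) (hc : IsClosed A) {p : Space n} (hp : sgnDist A p = 0) :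
    p ∈ frontier A := by
  rw [hc.frontier_eq]
  exact ⟨(sgnDist_nonneg_iff hA hc).1 hp.ge, fun h => (sgnDist_pos hA' h).ne' hp⟩

/-! ### The operation `ci`, regular Jordan sets, and measures of superlevel sets. -/

theorem ci_mono {n : ℕ} {X Y : Set (Space n)} (h : X ⊆ Y) : ci X ⊆ ci Y :=
  closure_mono (interior_mono h)

theorem ci_subset_closure {n : ℕ} (X : Set (Space n)) : ci X ⊆ closure X :=
  closure_mono interior_subset

theorem frontier_ci_subset {n : ℕ} (X : Set (Space n)) : frontier (ci X) ⊆ frontier X :=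
  Set.sdiff_subset_sdiff (closure_minimal (ci_subset_closure X) isClosed_closure)
    (interior_maximal subset_closure isOpen_interior)

/-- Both sets lie between the interior and the closure of `X`. -/
theorem ci_ae_eq {n : ℕ} {X : Set (Space n)} (h : volume (frontier X) = 0) :
    ci X =ᵐ[volume] X := by
  rw [ae_eq_set]
  constructor
  · exact measure_mono_null (t := frontier X)
      (fun p hp => ⟨ci_subset_closure X hp.1, fun h => hp.2 (interior_subset h)⟩) h
  · exact measure_mono_null (t := frontier X)
      (fun p hp => ⟨subset_closure hp.1, fun h => hp.2 (subset_closure h)⟩) h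

theorem ci_mem_regularJordan {n : ℕ} {X : Set (Space n)} (hb : Bornology.IsBounded X)
    (h : volume (frontier X) = 0) : ci X ∈ RegularJordan n :=
  ⟨hb.closure.subset (ci_subset_closure X), closure_interior_idem.symm,
    measure_mono_null (frontier_ci_subset X) h⟩

namespace RegularJordan

variable {n : ℕ} {A B : Set (Space n)}

theorem isClosed (hA : A ∈ RegularJordan n) : IsClosed A := by
  rw [hA.2.1]; exact isClosed_closure

theorem isCompact (hA : A ∈ RegularJordan n) : IsCompact A :=
  Metric.isCompact_of_isClosed_isBounded (isClosed hA) hA.1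

theorem volume_ne_top (hA : A ∈ RegularJordan n) : volume A ≠ ⊤ :=
  (isCompact hA).measure_lt_top.ne

theorem ne_univ [NeZero n] (hA : A ∈ RegularJordan n) : A ≠ Set.univ := by
  rintro rfl
  exact NormedSpace.unbounded_univ ℝ (Space n) hA.1

theorem ci_eq (hA : A ∈ RegularJordan n) : ci A = A := hA.2.1.symm

theorem ci_subset (hA : A ∈ RegularJordan n) {X : Set (Space n)} (h : X ⊆ A) : ci X ⊆ A :=
  (ci_mono h).trans_eq (ci_eq hA)

theorem empty : (∅ : Set (Space n)) ∈ RegularJordan n := by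
  simp [RegularJordan, ci]

theorem union (hA : A ∈ RegularJordan n) (hB : B ∈ RegularJordan n) :
    A ∪ B ∈ RegularJordan n := by
  refine ⟨hA.1.union hB.1, subset_antisymm ?_ ?_, ?_⟩
  · refine Set.union_subset ?_ ?_
    · exact (ci_eq hA).symm.trans_subset (ci_mono Set.subset_union_left)
    · exact (ci_eq hB).symm.trans_subset (ci_mono Set.subset_union_right)
  · exact (ci_subset_closure _).trans_eq ((isClosed hA).union (isClosed hB)).closure_eq
  · refine measure_mono_null (frontier_union_subset A B) (measure_union_null ?_ ?_)
    · exact measure_mono_null Set.inter_subset_left hA.2.2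
    · exact measure_mono_null Set.inter_subset_right hB.2.2

theorem biUnion {S : Set (Set (Space n))} (hS : S.Finite) {R : Set (Space n) → Set (Space n)}
    (hR : ∀ P ∈ S, R P ∈ RegularJordan n) : (⋃ P ∈ S, R P) ∈ RegularJordan n := by
  induction S, hS using Set.Finite.induction_on with
  | empty => simpa using empty
  | insert _ _ ih =>
    rw [Set.biUnion_insert]
    exact union (hR _ (Set.mem_insert _ _)) (ih fun P hP => hR P (Set.mem_insert_of_mem _ hP))

theorem nonempty_interior (hA : A ∈ RegularJordan n) (hne : A.Nonempty) :
    (interior A).Nonempty := by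
  rw [hA.2.1] at hne
  exact closure_nonempty_iff.1 hne

end RegularJordan

theorem subset_of_volume_diff_eq_zero {n : ℕ} {U K : Set (Space n)} (hU : IsOpen U)
    (hK : IsClosed K) (h : volume (U \ K) = 0) : U ⊆ K :=
  Set.sdiff_eq_empty.1 (((hU.sdiff hK).measure_eq_zero_iff volume).1 h)

/-- Together with `ci_subset_of_volume_le`, this handles parameters outside `[0, 1]`: an open set
minus a closed set is empty once it is null. -/
theorem subset_ci_of_subset_of_volume_le {n : ℕ} {B X Y : Set (Space n)}
    (hB : B ∈ RegularJordan n) (hX : IsClosed X) (hXB : X ⊆ Y) (hBY : B ⊆ Y)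
    (hY : volume Y ≠ ⊤) (hle : volume Y ≤ volume X) : B ⊆ ci X := by
  have h0 : volume (Y \ X) = 0 := by
    rw [measure_sdiff hXB hX.measurableSet.nullMeasurableSet
      (ne_top_of_le_ne_top hY (measure_mono hXB)), tsub_eq_zero_of_le hle]
  have h1 : interior B ⊆ X := subset_of_volume_diff_eq_zero isOpen_interior hX
    (measure_mono_null (Set.sdiff_subset_sdiff_left (interior_subset.trans hBY)) h0)
  rw [← RegularJordan.ci_eq hB]
  exact closure_mono (interior_maximal h1 isOpen_interior)

theorem ci_subset_of_volume_le {n : ℕ} {A X : Set (Space n)}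
    (hA : IsClosed A) (hAX : A ⊆ X) (hX : volume X ≠ ⊤) (hle : volume X ≤ volume A) :
    ci X ⊆ A := by
  have h0 : volume (X \ A) = 0 := by
    rw [measure_sdiff hAX hA.measurableSet.nullMeasurableSet
      (ne_top_of_le_ne_top hX (measure_mono hAX)), tsub_eq_zero_of_le hle]
  exact closure_minimal (subset_of_volume_diff_eq_zero isOpen_interior hA
    (measure_mono_null (Set.sdiff_subset_sdiff_left interior_subset) h0)) hA

/-- The measures of the superlevel sets of a continuous family of functions, within a set of finite
measure, depend continuously on the parameter. -/
theorem continuousWithinAt_volume_superlevel {n : ℕ} {A : Set (Space n)} (hA : MeasurableSet A)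
    (hfin : volume A ≠ ⊤) {φ : ℝ → Space n → ℝ} (hp : ∀ x, Continuous (φ x))
    (hx : ∀ p, Continuous fun x => φ x p) {s : Set ℝ} {x₀ : ℝ} (hx₀ : x₀ ∈ s)
    (hae : ∀ᵐ p ∂(volume : Measure (Space n)), φ x₀ p ≠ 0 ∨ ∀ x ∈ s, 0 ≤ φ x p) :
    ContinuousWithinAt (fun x => volume.real ({p | 0 ≤ φ x p} ∩ A)) s x₀ := by
  have hm : ∀ x, MeasurableSet ({p | 0 ≤ φ x p} ∩ A) := fun x =>
    (isClosed_le continuous_const (hp x)).measurableSet.inter hA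
  have h := tendsto_measure_of_ae_tendsto_indicator (μ := volume) (𝓝[s] x₀) (hm x₀) hm hA hfin
    (Eventually.of_forall fun x => Set.inter_subset_right) ?_
  · exact (ENNReal.tendsto_toReal
      (ne_top_of_le_ne_top hfin (measure_mono Set.inter_subset_right))).comp h
  -- Where `φ x₀ p ≠ 0` the sign is constant near `x₀`; in the other alternative the indicator is 1
  -- on all of `s`.
  filter_upwards [hae] with p hpp
  have hc : Tendsto (fun x => φ x p) (𝓝[s] x₀) (𝓝 (φ x₀ p)) :=
    ((hx p).tendsto x₀).mono_left nhdsWithin_le_nhds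
  rcases hpp with hne | hall
  · rcases hne.lt_or_gt with hlt | hgt
    · filter_upwards [hc.eventually_lt_const hlt] with x hxl
      simp [hxl.not_ge, hlt.not_ge]
    · filter_upwards [hc.eventually_const_lt hgt] with x hxl
      simp [hxl.le, hgt.le]
  · filter_upwards [self_mem_nhdsWithin] with x hxs
    simp [hall x hxs, hall x₀ hx₀]

/-! ### The simple average. -/

open Classical in
/-- The function that plays the role of the signed distance of the inner set. -/
noncomputable def innerDist {n : ℕ} (B : Set (Space n)) (q p : Space n) : ℝ :=
  if B.Nonempty then sgnDist B p else -dist p q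

theorem levelFun_eq {n : ℕ} (A B : Set (Space n)) (q : Space n) (x : ℝ) (p : Space n) :
    levelFun A B q x p = x * sgnDist A p + (1 - x) * innerDist B q p := rfl

section

variable {n : ℕ} {A B : Set (Space n)} {q : Space n}

theorem distanceAverage_one (hA : A ∈ RegularJordan n) (hne : A.Nonempty) :
    distanceAverage A B q 1 = A := by
  ext p
  rw [← sgnDist_nonneg_iff hne (RegularJordan.isClosed hA)]
  simp [distanceAverage, levelFun]

theorem subset_distanceAverage_zero (hB : B ∈ RegularJordan n) :
    B ⊆ distanceAverage A B q 0 := by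
  intro p hp
  have hne : B.Nonempty := ⟨p, hp⟩
  simpa [distanceAverage, levelFun, hne] using
    (sgnDist_nonneg_iff hne (RegularJordan.isClosed hB)).2 hp

theorem mem_cthickening_iff_infDist_le (hB : B.Nonempty) {r : ℝ} (hr : 0 ≤ r) {p : Space n} :
    p ∈ Metric.cthickening r B ↔ Metric.infDist p B ≤ r := by
  rw [Metric.mem_cthickening_iff,
    ENNReal.le_ofReal_iff_toReal_le (Metric.infEDist_ne_top hB) hr, Metric.infDist]

theorem weighted_volume_mem_Icc (hA : A ∈ RegularJordan n) (hBA : B ⊆ A) {t : ℝ}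
    (ht : t ∈ Set.Icc (0 : ℝ) 1) :
    t * volume.real A + (1 - t) * volume.real B ∈ Set.Icc (volume.real B) (volume.real A) := by
  have h : volume.real B ≤ volume.real A :=
    measureReal_mono hBA (RegularJordan.volume_ne_top hA)
  constructor
  · nlinarith [mul_nonneg ht.1 (sub_nonneg.2 h)]
  · nlinarith [mul_nonneg (sub_nonneg.2 ht.2) (sub_nonneg.2 h)]

/-- `M` is a regular Jordan set between `B` and `A` whose measure is the average of theirs. -/
structure IsIntermediate (t : ℝ) (A B M : Set (Space n)) : Prop where
  mem : M ∈ RegularJordan n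
  subset : M ⊆ A
  superset : B ⊆ M
  volume_eq : volume.real M = t * volume.real A + (1 - t) * volume.real B

theorem volume_frontier_cthickening (hB : B ∈ RegularJordan n) (hne : B.Nonempty) {r : ℝ}
    (hr : 0 ≤ r) : volume (frontier (Metric.cthickening r B)) = 0 := by
  rcases hr.eq_or_lt with rfl | hr
  · rw [Metric.cthickening_zero, (RegularJordan.isClosed hB).closure_eq]
    exact hB.2.2
  · have : Metric.cthickening r B = {p | Metric.infDist p B ≤ r} := by
      ext p; exact mem_cthickening_iff_infDist_le hne hr.le
    rw [this]
    exact measure_mono_null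
      (frontier_le_subset_eq (Metric.continuous_infDist_pt B) continuous_const)
      (volume_infDist_eq (RegularJordan.isClosed hB) hne hr.ne')

theorem volume_frontier_cthickening_inter (hA : A ∈ RegularJordan n) (hB : B ∈ RegularJordan n)
    (hne : B.Nonempty) {r : ℝ} (hr : 0 ≤ r) :
    volume (frontier (Metric.cthickening r B ∩ A)) = 0 := by
  refine measure_mono_null (frontier_inter_subset _ _) (measure_union_null ?_ ?_)
  · exact measure_mono_null Set.inter_subset_left (volume_frontier_cthickening hB hne hr)
  · exact measure_mono_null Set.inter_subset_right hA.2.2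

theorem continuousOn_volume_cthickening_inter (hA : A ∈ RegularJordan n)
    (hB : B ∈ RegularJordan n) (hne : B.Nonempty) (R : ℝ) :
    ContinuousOn (fun r => volume.real (Metric.cthickening r B ∩ A)) (Set.Icc 0 R) := by
  intro r₀ hr₀
  have h := continuousWithinAt_volume_superlevel (φ := fun r p => r - Metric.infDist p B)
    (RegularJordan.isClosed hA).measurableSet (RegularJordan.volume_ne_top hA)
    (fun r => continuous_const.sub (Metric.continuous_infDist_pt B))
    (fun p => continuous_id.sub continuous_const) hr₀ ?_
  · have key : ∀ r ∈ Set.Icc (0 : ℝ) R, volume.real (Metric.cthickening r B ∩ A)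
        = volume.real ({p | 0 ≤ r - Metric.infDist p B} ∩ A) := by
      intro r hr
      congr 2
      ext p
      rw [mem_cthickening_iff_infDist_le hne hr.1]
      simp
    exact h.congr key (key r₀ hr₀)
  rcases hr₀.1.eq_or_lt with rfl | hpos
  -- At `r₀ = 0` the zero set of the distance is `B` itself, usually not null, but its points belong
  -- to every offset.
  · refine Eventually.of_forall fun p => ?_
    rcases eq_or_ne (Metric.infDist p B) 0 with h0 | h0
    · right
      intro r hr
      rw [h0, sub_zero]
      exact hr.1
    · left
      simpa using h0
  · filter_upwards [measure_eq_zero_iff_ae_notMem.1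
      (volume_infDist_eq (RegularJordan.isClosed hB) hne hpos.ne')] with p hp
    left
    rw [sub_ne_zero]
    exact fun h => hp h.symm

theorem exists_volume_cthickening_inter_eq (hA : A ∈ RegularJordan n) (hBA : B ⊆ A)
    (hB : B ∈ RegularJordan n) (hne : B.Nonempty) {t : ℝ} (ht : t ∈ Set.Icc (0 : ℝ) 1) :
    ∃ r : ℝ, 0 ≤ r ∧ volume.real (Metric.cthickening r B ∩ A)
      = t * volume.real A + (1 - t) * volume.real B := by
  have ⟨b, hb⟩ := hne
  obtain ⟨R, hR⟩ := hA.1.subset_closedBall b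
  have hR0 : 0 ≤ R := dist_nonneg.trans (hR (hBA hb))
  obtain ⟨r, hr, hrm⟩ := intermediate_value_Icc hR0
    (continuousOn_volume_cthickening_inter hA hB hne R)
    (show t * volume.real A + (1 - t) * volume.real B ∈ _ by
      have h0 : Metric.cthickening 0 B ∩ A = B := by
        rw [Metric.cthickening_zero, (RegularJordan.isClosed hB).closure_eq]
        exact Set.inter_eq_left.2 hBA
      have h1 : Metric.cthickening R B ∩ A = A := by
        refine Set.inter_eq_right.2 fun p hp => ?_
        rw [mem_cthickening_iff_infDist_le hne hR0]
        exact (Metric.infDist_le_dist_of_mem hb).trans (hR hp)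
      rw [h0, h1]
      exact weighted_volume_mem_Icc hA hBA ht)
  exact ⟨r, hr.1, hrm⟩

variable [NeZero n]

theorem isDistLike_innerDist (hB : B ∈ RegularJordan n) (q : Space n) :
    IsDistLike (innerDist B q) := by
  by_cases h : B.Nonempty
  · have : innerDist B q = sgnDist B := by ext p; simp [innerDist, h]
    rw [this]
    exact isDistLike_sgnDist h (RegularJordan.ne_univ hB)
  · have : innerDist B q = fun p => -dist p q := by ext p; simp [innerDist, h]
    rw [this]
    exact isDistLike_neg_dist q

theorem exists_isCenter (hA : A ∈ RegularJordan n) (hne : A.Nonempty) : ∃ q, IsCenter A q := by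
  obtain ⟨q, hq, hmax⟩ := (RegularJordan.isCompact hA).exists_isMaxOn hne
    (isDistLike_sgnDist hne (RegularJordan.ne_univ hA)).lipschitz.continuous.continuousOn
  exact ⟨q, hq, hmax⟩

theorem IsCenter.sgnDist_pos (hA : A ∈ RegularJordan n) (hq : IsCenter A q) :
    0 < sgnDist A q := by
  obtain ⟨a, ha⟩ := RegularJordan.nonempty_interior hA ⟨q, hq.1⟩
  exact (SetAverage.sgnDist_pos (RegularJordan.ne_univ hA) ha).trans_le
    (hq.2 a (interior_subset ha))

theorem volume_sgnDist_eq_zero (hA : A ∈ RegularJordan n) (hne : A.Nonempty) :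
    volume {p | sgnDist A p = 0} = 0 :=
  measure_mono_null (fun _ hp => mem_frontier_of_sgnDist_eq_zero hne (RegularJordan.ne_univ hA)
    (RegularJordan.isClosed hA) hp) hA.2.2

theorem volume_innerDist_eq_zero (hB : B ∈ RegularJordan n) (q : Space n) :
    volume {p | innerDist B q p = 0} = 0 := by
  by_cases h : B.Nonempty
  · simpa [innerDist, h] using volume_sgnDist_eq_zero hB h
  · simp [innerDist, h]

/-- For empty `B` this is the Lipschitz bound from `q`, where the signed distance is nonnegative. It
makes the distance averages increase with the parameter. -/
theorem innerDist_le_sgnDist (hA : A ∈ RegularJordan n) (hBA : B ⊆ A) (hq : q ∈ A)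
    (p : Space n) : innerDist B q p ≤ sgnDist A p := by
  by_cases h : B.Nonempty
  · simpa [innerDist, h] using sgnDist_mono h (RegularJordan.ne_univ hA) hBA p
  · have h1 := (isDistLike_sgnDist ⟨q, hq⟩ (RegularJordan.ne_univ hA)).lipschitz.dist_le_mul p q
    have h2 := (sgnDist_nonneg_iff ⟨q, hq⟩ (RegularJordan.isClosed hA)).2 hq
    rw [NNReal.coe_one, one_mul, Real.dist_eq] at h1
    simp only [innerDist, h, if_false]
    linarith [neg_abs_le (sgnDist A p - sgnDist A q)]

theorem continuous_levelFun (hA : A ∈ RegularJordan n) (hne : A.Nonempty)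
    (hB : B ∈ RegularJordan n) (q : Space n) (x : ℝ) : Continuous (levelFun A B q x) := by
  have h1 := (isDistLike_sgnDist hne (RegularJordan.ne_univ hA)).lipschitz.continuous
  have h2 := (isDistLike_innerDist hB q).lipschitz.continuous
  exact (h1.const_mul x).add (h2.const_mul (1 - x))

theorem isClosed_distanceAverage (hA : A ∈ RegularJordan n) (hne : A.Nonempty)
    (hB : B ∈ RegularJordan n) (q : Space n) (x : ℝ) : IsClosed (distanceAverage A B q x) :=
  isClosed_le continuous_const (continuous_levelFun hA hne hB q x)

theorem distanceAverage_mono (hA : A ∈ RegularJordan n) (hBA : B ⊆ A) (hq : q ∈ A) {x y : ℝ}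
    (hxy : x ≤ y) : distanceAverage A B q x ⊆ distanceAverage A B q y := by
  intro p hp
  have h := innerDist_le_sgnDist hA hBA hq p
  have hp' : 0 ≤ levelFun A B q x p := hp
  change 0 ≤ levelFun A B q y p
  rw [levelFun_eq] at hp' ⊢
  nlinarith [mul_nonneg (sub_nonneg.2 hxy) (sub_nonneg.2 h)]

/-- For empty `B` the level set reduces to `{q}`: not empty, but null. -/
theorem volume_distanceAverage_zero (hB : B ∈ RegularJordan n) :
    volume (distanceAverage A B q 0) = volume B := by
  by_cases hne : B.Nonempty
  · congr 1
    ext p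
    rw [← sgnDist_nonneg_iff hne (RegularJordan.isClosed hB)]
    simp [distanceAverage, levelFun, hne]
  · have : distanceAverage A B q 0 ⊆ {q} := by
      intro p hp
      have hp' : 0 ≤ levelFun A B q 0 p := hp
      simpa [levelFun, hne] using hp'
    rw [measure_mono_null this (measure_singleton q), Set.not_nonempty_iff_eq_empty.1 hne,
      measure_empty]

/-- Away from `x = 1/2` one of the coefficients `x`, `1 - x` dominates in absolute value, and the
zero set of the dominating function is itself null. -/
theorem volume_levelFun_eq_zero (hA : A ∈ RegularJordan n) (hne : A.Nonempty)
    (hB : B ∈ RegularJordan n) (hz : ZeroMeasureCondition A B q) (x : ℝ) :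
    volume {p | levelFun A B q x p = 0} = 0 := by
  have hu := isDistLike_sgnDist hne (RegularJordan.ne_univ hA)
  have hv := isDistLike_innerDist hB q
  rcases lt_trichotomy x (1 / 2) with hlt | rfl | hgt
  · have hlt' : |x| < |1 - x| := by rw [← sq_lt_sq]; nlinarith
    have h := measure_union_null (hv.volume_zeros hu.lipschitz hlt')
      (volume_innerDist_eq_zero hB q)
    refine measure_mono_null (fun p hp => ?_) h
    have hp' : levelFun A B q x p = 0 := hp
    rw [levelFun_eq] at hp'
    by_cases h0 : innerDist B q p = 0
    · exact Or.inr h0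
    · exact Or.inl ⟨by linarith, h0⟩
  · exact hz
  · have hlt' : |1 - x| < |x| := by rw [← sq_lt_sq]; nlinarith
    have h := measure_union_null (hu.volume_zeros hv.lipschitz hlt')
      (volume_sgnDist_eq_zero hA hne)
    refine measure_mono_null (fun p hp => ?_) h
    have hp' : levelFun A B q x p = 0 := hp
    rw [levelFun_eq] at hp'
    by_cases h0 : sgnDist A p = 0
    · exact Or.inr h0
    · exact Or.inl ⟨hp', h0⟩

theorem isBounded_distanceAverage (hA : A ∈ RegularJordan n) (hBA : B ⊆ A)
    (hB : B ∈ RegularJordan n) (hq : q ∈ A) (x : ℝ) :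
    Bornology.IsBounded (distanceAverage A B q x) := by
  have hne : A.Nonempty := ⟨q, hq⟩
  rcases le_or_gt x 1 with hx | hx
  · exact hA.1.subset
      ((distanceAverage_mono hA hBA hq hx).trans_eq (distanceAverage_one hA hne))
  -- For `x > 1` and `p ∉ A`, with `b` a zero of the inner function and `A` within `D` of `b`, the
  -- level function is at most `-x (|p - b| - D) + (x - 1) |p - b| = x D - |p - b|`.
  have hv := isDistLike_innerDist hB q
  obtain ⟨b, hb, -⟩ := hv.exists_zero q
  obtain ⟨D, hD⟩ := hA.1.subset_closedBall b
  refine (hA.1.union (Metric.isBounded_closedBall (x := b) (r := x * D))).subset fun p hp => ?_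
  have hp' : 0 ≤ levelFun A B q x p := hp
  rw [levelFun_eq] at hp'
  by_cases hpA : p ∈ A
  · exact Or.inl hpA
  right
  have h1 := hv.lipschitz.dist_le_mul p b
  rw [hb, NNReal.coe_one, one_mul, Real.dist_eq, sub_zero] at h1
  have h2 : -dist p b ≤ innerDist B q p := by linarith [neg_abs_le (innerDist B q p)]
  have h3 : dist p b - D ≤ Metric.infDist p A := by
    rw [Metric.le_infDist hne]
    intro y hy
    have h4 : dist y b ≤ D := hD hy
    linarith [dist_triangle p y b]
  rw [(sgnDist_of_notMem hne hpA).1] at hp'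
  rw [Metric.mem_closedBall]
  nlinarith [mul_nonneg (sub_nonneg.2 hx.le) (by linarith : 0 ≤ dist p b + innerDist B q p),
    mul_nonneg (zero_le_one.trans hx.le)
      (by linarith : 0 ≤ Metric.infDist p A - (dist p b - D))]

theorem volume_frontier_distanceAverage (hA : A ∈ RegularJordan n) (hne : A.Nonempty)
    (hB : B ∈ RegularJordan n) (hz : ZeroMeasureCondition A B q) (x : ℝ) :
    volume (frontier (distanceAverage A B q x)) = 0 := by
  refine measure_mono_null (fun p hp => ?_) (volume_levelFun_eq_zero hA hne hB hz x)
  exact (frontier_le_subset_eq continuous_const (continuous_levelFun hA hne hB q x) hp).symm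

theorem continuousOn_volume_distanceAverage (hA : A ∈ RegularJordan n) (hBA : B ⊆ A)
    (hB : B ∈ RegularJordan n) (hq : q ∈ A) (hz : ZeroMeasureCondition A B q) :
    ContinuousOn (fun x => volume.real (distanceAverage A B q x)) (Set.Icc 0 1) := by
  have hne : A.Nonempty := ⟨q, hq⟩
  intro x₀ hx₀
  have h := continuousWithinAt_volume_superlevel (RegularJordan.isClosed hA).measurableSet
    (RegularJordan.volume_ne_top hA) (continuous_levelFun hA hne hB q)
    (fun p => (continuous_id.mul continuous_const).add
      ((continuous_const.sub continuous_id).mul continuous_const)) hx₀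
    (by
      filter_upwards [measure_eq_zero_iff_ae_notMem.1 (volume_levelFun_eq_zero hA hne hB hz x₀)]
        with p hp using Or.inl hp)
  have key : ∀ x ∈ Set.Icc (0 : ℝ) 1,
      volume.real (distanceAverage A B q x) = volume.real ({p | 0 ≤ levelFun A B q x p} ∩ A) := by
    intro x hx
    congr 1
    refine (Set.inter_eq_left.2 ?_).symm
    exact (distanceAverage_mono hA hBA hq hx.2).trans_eq (distanceAverage_one hA hne)
  exact h.congr key (key x₀ hx₀)

/-- Consequently the offset construction is only ever applied to nonempty `B`. -/
theorem zeroMeasureCondition_empty (hA : A ∈ RegularJordan n) (hq : IsCenter A q) :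
    ZeroMeasureCondition A ∅ q := by
  have h := volume_dist_eq_of_center
    (isDistLike_sgnDist ⟨q, hq.1⟩ (RegularJordan.ne_univ hA)) (hq.sgnDist_pos hA)
  refine measure_mono_null (fun p hp => ?_) h
  have hp' : levelFun A ∅ q (1 / 2) p = 0 := hp
  simp only [levelFun, Set.not_nonempty_empty, if_false] at hp'
  change sgnDist A p - dist p q = 0
  linarith

theorem exists_volume_distanceAverage_eq (hA : A ∈ RegularJordan n) (hBA : B ⊆ A)
    (hB : B ∈ RegularJordan n) (hq : q ∈ A) (hz : ZeroMeasureCondition A B q) {t : ℝ}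
    (ht : t ∈ Set.Icc (0 : ℝ) 1) : ∃ g ∈ Set.Icc (0 : ℝ) 1,
      volume.real (distanceAverage A B q g) = t * volume.real A + (1 - t) * volume.real B := by
  refine intermediate_value_Icc zero_le_one
    (continuousOn_volume_distanceAverage hA hBA hB hq hz) ?_
  have h0 : volume.real (distanceAverage A B q 0) = volume.real B := by
    rw [measureReal_def, volume_distanceAverage_zero hB, measureReal_def]
  rw [h0, distanceAverage_one hA ⟨q, hq⟩]
  exact weighted_volume_mem_Icc hA hBA ht

theorem IsSimpleAverage.exists_of_subset (hA : A ∈ RegularJordan n) (hne : A.Nonempty)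
    (hBA : B ⊆ A) (hB : B ∈ RegularJordan n) {N t : ℝ} (hN : 1 ≤ N)
    (ht : t ∈ Set.Icc (0 : ℝ) 1) : ∃ M, IsSimpleAverage N t A B M := by
  obtain ⟨q, hq⟩ := exists_isCenter hA hne
  by_cases hz : ZeroMeasureCondition A B q
  · obtain ⟨g, hg, hgm⟩ := exists_volume_distanceAverage_eq hA hBA hB hq.1 hz ht
    refine ⟨_, q, hq, Or.inl ⟨hz, g, ⟨by linarith [hg.1], by linarith [hg.2]⟩, ?_, rfl⟩⟩
    intro x _
    simp [hgm]
  · have hBne : B.Nonempty := by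
      by_contra h
      rw [Set.not_nonempty_iff_eq_empty.1 h] at hz
      exact hz (zeroMeasureCondition_empty hA hq)
    obtain ⟨r, hr, hrm⟩ := exists_volume_cthickening_inter_eq hA hBA hB hBne ht
    exact ⟨_, q, hq, Or.inr ⟨hz, r, hr, hrm, rfl⟩⟩

theorem IsSimpleAverage.isIntermediate (hA : A ∈ RegularJordan n) (hBA : B ⊆ A)
    (hB : B ∈ RegularJordan n) {N t : ℝ} (hN : 1 ≤ N) (ht : t ∈ Set.Icc (0 : ℝ) 1)
    {M : Set (Space n)} (h : IsSimpleAverage N t A B M) : IsIntermediate t A B M := by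
  obtain ⟨q, hq, ⟨hz, g, hg, hmin, rfl⟩ | ⟨hz, r, hr, hrm, rfl⟩⟩ := h
  · have hne : A.Nonempty := ⟨q, hq.1⟩
    set S := distanceAverage A B q with hS
    -- Deviation 0 is attained in `[0, 1] ⊆ [-N, N]`, so every minimizer attains it, even one
    -- outside `[0, 1]`.
    have hvol : volume.real (S g) = t * volume.real A + (1 - t) * volume.real B := by
      obtain ⟨x, hx, hxm⟩ := exists_volume_distanceAverage_eq hA hBA hB hq.1 hz ht
      have h1 := hmin (show x ∈ Set.Icc (-N) N from ⟨by linarith [hx.1], by linarith [hx.2]⟩)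
      simp only [Set.mem_ofPred_eq] at h1
      rw [hxm, sub_self, abs_zero] at h1
      exact sub_eq_zero.1 (abs_nonpos_iff.1 h1)
    have hfr := volume_frontier_distanceAverage hA hne hB hz g
    have hbd := isBounded_distanceAverage hA hBA hB hq.1 g
    have hcl := isClosed_distanceAverage hA hne hB q
    have hm := weighted_volume_mem_Icc hA hBA ht
    have htop : ∀ x, volume (S x) ≠ ⊤ := fun x =>
      (isBounded_distanceAverage hA hBA hB hq.1 x).measure_lt_top.ne
    have h1 : S 1 = A := distanceAverage_one hA hne
    refine ⟨ci_mem_regularJordan hbd hfr, ?_, ?_, ?_⟩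
    · rcases le_total g 1 with hg1 | hg1
      · exact RegularJordan.ci_subset hA ((distanceAverage_mono hA hBA hq.1 hg1).trans_eq h1)
      -- For `g ≥ 1` the set `S g` contains `A` but has no larger measure, so the excess is null and
      -- `ci` removes it.
      · refine ci_subset_of_volume_le (RegularJordan.isClosed hA)
          (h1.symm.trans_subset (distanceAverage_mono hA hBA hq.1 hg1)) (htop g) ?_
        rw [← ENNReal.toReal_le_toReal (htop g) (RegularJordan.volume_ne_top hA)]
        exact hvol.trans_le hm.2
    · rcases le_total 0 g with hg0 | hg0
      · rw [← RegularJordan.ci_eq hB]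
        exact ci_mono ((subset_distanceAverage_zero hB).trans
          (distanceAverage_mono hA hBA hq.1 hg0))
      · refine subset_ci_of_subset_of_volume_le hB (hcl g)
          (distanceAverage_mono hA hBA hq.1 hg0) (subset_distanceAverage_zero hB) (htop 0) ?_
        rw [volume_distanceAverage_zero hB,
          ← ENNReal.toReal_le_toReal (RegularJordan.volume_ne_top hB) (htop g)]
        exact hm.1.trans_eq hvol.symm
    · rw [measureReal_congr (ci_ae_eq hfr), hvol]
  · have hBne : B.Nonempty := by
      by_contra h
      rw [Set.not_nonempty_iff_eq_empty.1 h] at hz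
      exact hz (zeroMeasureCondition_empty hA hq)
    have hfr := volume_frontier_cthickening_inter hA hB hBne hr
    refine ⟨ci_mem_regularJordan (hA.1.subset Set.inter_subset_right) hfr,
      RegularJordan.ci_subset hA Set.inter_subset_right, ?_, ?_⟩
    · nth_rw 1 [← RegularJordan.ci_eq hB]
      exact ci_mono (Set.subset_inter (Metric.self_subset_cthickening B) hBA)
    · rw [measureReal_congr (ci_ae_eq hfr), hrm]

end

/-! ### Connected components and pieces of the difference. -/

section

variable {n : ℕ} {A B D : Set (Space n)}

theorem eq_connectedComponentIn_of_mem {C : Set (Space n)} (hC : C ∈ components D) {z : Space n}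
    (hz : z ∈ C) : C = connectedComponentIn D z := by
  obtain ⟨p, -, rfl⟩ := hC
  exact connectedComponentIn_eq hz

theorem components_pairwiseDisjoint (D : Set (Space n)) :
    (components D).PairwiseDisjoint id := by
  intro C hC C' hC' hne
  refine Set.disjoint_left.2 fun z hz hz' => hne ?_
  exact (eq_connectedComponentIn_of_mem hC hz).trans (eq_connectedComponentIn_of_mem hC' hz').symm

theorem sUnion_components (D : Set (Space n)) : ⋃₀ components D = D := by
  refine subset_antisymm (Set.sUnion_subset ?_) fun p hp => ?_
  · rintro _ ⟨p, -, rfl⟩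
    exact connectedComponentIn_subset D p
  · exact ⟨_, ⟨p, hp, rfl⟩, mem_connectedComponentIn hp⟩

theorem nonempty_of_mem_components {C : Set (Space n)} (hC : C ∈ components D) : C.Nonempty := by
  obtain ⟨p, hp, rfl⟩ := hC
  exact ⟨p, mem_connectedComponentIn hp⟩

/-- Components are relatively closed: a set between a connected set and its closure is connected. -/
theorem closure_inter_subset_of_mem_components {C : Set (Space n)} (hC : C ∈ components D) :
    closure C ∩ D ⊆ C := by
  obtain ⟨p, hp, rfl⟩ := hC
  have hpc := mem_connectedComponentIn hp
  have hpre : IsPreconnected (closure (connectedComponentIn D p) ∩ D) :=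
    isPreconnected_connectedComponentIn.subset_closure
      (Set.subset_inter subset_closure (connectedComponentIn_subset D p)) Set.inter_subset_left
  exact hpre.subset_connectedComponentIn ⟨subset_closure hpc, hp⟩ Set.inter_subset_right

theorem sUnion_eq_diff {S : Set (Set (Space n))} (hS : S ⊆ components D) :
    ⋃₀ S = D \ ⋃₀ (components D \ S) := by
  ext p
  constructor
  · rintro ⟨C, hC, hp⟩
    refine ⟨sUnion_components D ▸ ⟨C, hS hC, hp⟩, ?_⟩
    rintro ⟨C', hC', hp'⟩
    have : C = C' := (components_pairwiseDisjoint D).elim_set (hS hC) hC'.1 p hp hp'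
    exact hC'.2 (this ▸ hC)
  · rintro ⟨hpD, hp⟩
    rw [← sUnion_components D] at hpD
    obtain ⟨C, hC, hpC⟩ := hpD
    by_cases h : C ∈ S
    · exact ⟨C, h, hpC⟩
    · exact absurd ⟨C, ⟨hC, h⟩, hpC⟩ hp

theorem disjoint_sUnion_components {S T : Set (Set (Space n))} (hS : S ⊆ components D)
    (hT : T ⊆ components D) (hST : Disjoint S T) : Disjoint (⋃₀ S) (⋃₀ T) := by
  rw [Set.disjoint_left]
  rintro p ⟨C, hC, hp⟩ ⟨C', hC', hp'⟩
  have : C = C' := (components_pairwiseDisjoint D).elim_set (hS hC) (hT hC') p hp hp'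
  exact Set.disjoint_left.1 hST hC (this ▸ hC')

/-- Points of the boundary of a union of components of `A \ B` lie in the boundary of `A` or `B`. -/
theorem frontier_sUnion_components_subset (hA : IsClosed A) (hB : IsClosed B)
    {S : Set (Set (Space n))} (hS : S ⊆ components (A \ B)) :
    frontier (⋃₀ S) ⊆ frontier A ∪ frontier B := by
  intro p hp
  have hSD : ⋃₀ S ⊆ A \ B := (Set.sUnion_mono hS).trans_eq (sUnion_components _)
  have hpA : p ∈ A := hA.closure_subset_iff.2 (hSD.trans Set.sdiff_subset) hp.1
  by_contra hcon
  rw [Set.mem_union, not_or] at hcon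
  have hpA' : p ∈ interior A := by
    by_contra h
    exact hcon.1 ⟨subset_closure hpA, h⟩
  have hpB : p ∉ B := by
    intro h
    have h1 : p ∈ closure Bᶜ := closure_mono (fun z hz => (hSD hz).2) hp.1
    rw [closure_compl] at h1
    exact hcon.2 ⟨subset_closure h, h1⟩
  have hop : IsOpen (interior A ∩ Bᶜ) := isOpen_interior.inter hB.isOpen_compl
  obtain ⟨δ, hδ, hball⟩ := Metric.isOpen_iff.1 hop p ⟨hpA', hpB⟩
  obtain ⟨z, hz, hzp⟩ := Metric.mem_closure_iff.1 hp.1 δ hδ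
  obtain ⟨C, hC, hzC⟩ := hz
  -- A ball inside `A \ B` is connected, so it lies in the component that it meets.
  have hsub : Metric.ball p δ ⊆ C := by
    rw [eq_connectedComponentIn_of_mem (hS hC) hzC]
    refine (convex_ball p δ).isPreconnected.subset_connectedComponentIn ?_ ?_
    · rwa [Metric.mem_ball, dist_comm]
    · exact fun y hy => ⟨interior_subset (hball hy).1, (hball hy).2⟩
  exact hp.2 (interior_maximal (hsub.trans (Set.subset_sUnion_of_mem hC)) Metric.isOpen_ball
    (Metric.mem_ball_self hδ))

theorem volume_frontier_sUnion_components (hA : A ∈ RegularJordan n) (hB : B ∈ RegularJordan n)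
    {S : Set (Set (Space n))} (hS : S ⊆ components (A \ B)) : volume (frontier (⋃₀ S)) = 0 :=
  measure_mono_null (frontier_sUnion_components_subset (RegularJordan.isClosed hA)
    (RegularJordan.isClosed hB) hS) (measure_union_null hA.2.2 hB.2.2)

/-- Removing finitely many relatively closed components leaves a relatively open subset of `A \ B`,
which meets `interior A` because `A` is the closure of its interior. Finiteness matters: among
infinitely many components, a single one may be just a point. -/
theorem nonempty_interior_sUnion_components (hA : A ∈ RegularJordan n)
    (hB : B ∈ RegularJordan n) {S : Set (Set (Space n))} (hS : S ⊆ components (A \ B))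
    (hfin : (components (A \ B) \ S).Finite) (hne : S.Nonempty) :
    (interior (⋃₀ S)).Nonempty := by
  obtain ⟨C, hC⟩ := hne
  obtain ⟨p, hp⟩ := nonempty_of_mem_components (hS hC)
  have hpS : p ∈ ⋃₀ S := ⟨C, hC, hp⟩
  rw [sUnion_eq_diff hS] at hpS ⊢
  set T := components (A \ B) \ S with hT
  have hcl : closure (⋃₀ T) ∩ (A \ B) ⊆ ⋃₀ T := by
    rw [hfin.closure_sUnion]
    rintro z ⟨hz, hzD⟩
    obtain ⟨E, hE, hzE⟩ := Set.mem_iUnion₂.1 hz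
    exact ⟨E, hE, closure_inter_subset_of_mem_components hE.1 ⟨hzE, hzD⟩⟩
  have hpT : p ∉ closure (⋃₀ T) := fun h => hpS.2 (hcl ⟨h, hpS.1⟩)
  have hV : IsOpen ((closure (⋃₀ T))ᶜ ∩ Bᶜ) :=
    isClosed_closure.isOpen_compl.inter (RegularJordan.isClosed hB).isOpen_compl
  have hpA : p ∈ closure (interior A) := hA.2.1.subset hpS.1.1
  obtain ⟨z, hzV, hzA⟩ := mem_closure_iff.1 hpA _ hV ⟨hpT, hpS.1.2⟩
  refine ⟨z, interior_maximal ?_ (hV.inter isOpen_interior) ⟨hzV, hzA⟩⟩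
  rintro y ⟨⟨hy1, hy2⟩, hy3⟩
  exact ⟨⟨interior_subset hy3, hy2⟩, fun h => hy1 (subset_closure h)⟩

/-- Disjoint sets of measure at least `ε` inside a set of finite measure; null boundaries make them
measurable. -/
theorem finite_large_components (hA : A ∈ RegularJordan n) (hB : B ∈ RegularJordan n) {ε : ℝ}
    (hε : 0 < ε) : {C ∈ components (A \ B) | ε ≤ volume.real C}.Finite := by
  have hsub : ∀ C ∈ components (A \ B), C ⊆ A := fun C hC =>
    (Set.subset_sUnion_of_mem hC).trans ((sUnion_components _).trans_subset Set.sdiff_subset)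
  have h := Measure.finite_const_le_meas_of_disjoint_iUnion₀ (volume : Measure (Space n))
    (ENNReal.ofReal_pos.2 hε) (As := fun C : components (A \ B) => (C : Set (Space n)))
    (fun C => by
      have := volume_frontier_sUnion_components hA hB (Set.singleton_subset_iff.2 C.2)
      rw [Set.sUnion_singleton] at this
      exact nullMeasurableSet_of_null_frontier this)
    (fun C C' hne => ((components_pairwiseDisjoint _) C.2 C'.2
      (fun h => hne (Subtype.ext h))).aedisjoint)
    (ne_top_of_le_ne_top (RegularJordan.volume_ne_top hA)
      (measure_mono (Set.iUnion_subset fun C => hsub C C.2)))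
  refine (h.image Subtype.val).subset ?_
  rintro C ⟨hC, hCε⟩
  refine ⟨⟨C, hC⟩, ?_, rfl⟩
  exact (ENNReal.ofReal_le_iff_le_toReal
    (ne_top_of_le_ne_top (RegularJordan.volume_ne_top hA) (measure_mono (hsub C hC)))).2 hCε

theorem nonempty_interior_of_volume_pos {P : Set (Space n)} (hfr : volume (frontier P) = 0)
    (hP : 0 < volume.real P) : (interior P).Nonempty := by
  by_contra h
  have h0 : volume P = 0 := by
    refine measure_mono_null (fun p hp => ?_) hfr
    exact ⟨subset_closure hp, fun hi => h ⟨p, hi⟩⟩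
  rw [measureReal_def, h0] at hP
  exact lt_irrefl _ hP

theorem exists_eq_sUnion_of_mem_pieces {ε : ℝ} {P : Set (Space n)} (hP : P ∈ pieces ε A B) :
    ∃ S ⊆ components (A \ B), P = ⋃₀ S := by
  unfold pieces at hP
  split_ifs at hP with hfin
  · exact ⟨{P}, Set.singleton_subset_iff.2 hP, (Set.sUnion_singleton P).symm⟩
  · rcases hP with rfl | hP
    · exact ⟨_, fun C hC => hC.1, rfl⟩
    · exact ⟨{P}, Set.singleton_subset_iff.2 hP.1, (Set.sUnion_singleton P).symm⟩

theorem volume_frontier_of_mem_pieces (hA : A ∈ RegularJordan n) (hB : B ∈ RegularJordan n)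
    {ε : ℝ} {P : Set (Space n)} (hP : P ∈ pieces ε A B) : volume (frontier P) = 0 := by
  obtain ⟨S, hS, rfl⟩ := exists_eq_sUnion_of_mem_pieces hP
  exact volume_frontier_sUnion_components hA hB hS

theorem finite_pieces (hA : A ∈ RegularJordan n) (hB : B ∈ RegularJordan n) {ε : ℝ}
    (hε : 0 < ε) : (pieces ε A B).Finite := by
  unfold pieces
  split_ifs with hfin
  · exact hfin
  · exact (finite_large_components hA hB hε).insert _

theorem sUnion_pieces (ε : ℝ) (A B : Set (Space n)) : ⋃₀ pieces ε A B = A \ B := by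
  unfold pieces
  split_ifs with hfin
  · exact sUnion_components _
  · rw [Set.sUnion_insert, ← Set.sUnion_union, ← Set.sep_or]
    simp only [lt_or_ge, Set.sep_true, sUnion_components]

theorem pieces_pairwiseDisjoint (ε : ℝ) (A B : Set (Space n)) :
    (pieces ε A B).PairwiseDisjoint id := by
  unfold pieces
  split_ifs with hfin
  · exact components_pairwiseDisjoint _
  · refine Set.PairwiseDisjoint.insert
      ((components_pairwiseDisjoint _).subset fun C hC => hC.1) fun C hC _ => ?_
    have := disjoint_sUnion_components (D := A \ B)
      (S := {C ∈ components (A \ B) | volume.real C < ε}) (fun C hC => hC.1)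
      (Set.singleton_subset_iff.2 hC.1)
      (Set.disjoint_singleton_right.2 fun h => h.2.not_ge hC.2)
    rwa [Set.sUnion_singleton] at this

theorem nonempty_interior_of_mem_pieces (hA : A ∈ RegularJordan n) (hB : B ∈ RegularJordan n)
    {ε : ℝ} (hε : 0 < ε) {P : Set (Space n)} (hP : P ∈ pieces ε A B) :
    (interior P).Nonempty := by
  have hfr := volume_frontier_of_mem_pieces hA hB hP
  unfold pieces at hP
  split_ifs at hP with hfin
  · have := nonempty_interior_sUnion_components hA hB (Set.singleton_subset_iff.2 hP)
      (hfin.subset Set.sdiff_subset) (Set.singleton_nonempty P)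
    rwa [Set.sUnion_singleton] at this
  · rcases hP with rfl | hP
    · refine nonempty_interior_sUnion_components hA hB (fun C hC => hC.1)
        ((finite_large_components hA hB hε).subset ?_) ?_
      · rintro C ⟨hC, hC'⟩
        exact ⟨hC, not_lt.1 fun h => hC' ⟨hC, h⟩⟩
      -- Without small components all would be large, hence finite in number.
      · by_contra hempty
        refine hfin ((finite_large_components hA hB hε).subset fun C hC => ⟨hC, ?_⟩)
        exact not_lt.1 fun h => hempty ⟨C, hC, h⟩
    · exact nonempty_interior_of_volume_pos hfr (hε.trans_le hP.2)

end

/-! ### Nested averages: adding up the pieces. -/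

section

variable {n : ℕ} {A B : Set (Space n)}

theorem volume_frontier_union_piece (hA : A ∈ RegularJordan n) (hB : B ∈ RegularJordan n)
    {ε : ℝ} {P : Set (Space n)} (hP : P ∈ pieces ε A B) : volume (frontier (B ∪ P)) = 0 :=
  measure_mono_null (frontier_union_subset B P) (measure_union_null
    (measure_mono_null Set.inter_subset_left hB.2.2)
    (measure_mono_null Set.inter_subset_right (volume_frontier_of_mem_pieces hA hB hP)))

theorem piece_subset_diff {ε : ℝ} {P : Set (Space n)} (hP : P ∈ pieces ε A B) : P ⊆ A \ B :=
  (Set.subset_sUnion_of_mem hP).trans_eq (sUnion_pieces ε A B)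

theorem ci_union_piece_mem (hA : A ∈ RegularJordan n) (hB : B ∈ RegularJordan n)
    {ε : ℝ} {P : Set (Space n)} (hP : P ∈ pieces ε A B) : ci (B ∪ P) ∈ RegularJordan n :=
  ci_mem_regularJordan (hB.1.union (hA.1.subset ((piece_subset_diff hP).trans Set.sdiff_subset)))
    (volume_frontier_union_piece hA hB hP)

theorem subset_ci_union_piece (hB : B ∈ RegularJordan n) (P : Set (Space n)) :
    B ⊆ ci (B ∪ P) := by
  nth_rw 1 [← RegularJordan.ci_eq hB]
  exact ci_mono Set.subset_union_left

theorem volume_ci_union_piece (hA : A ∈ RegularJordan n) (hB : B ∈ RegularJordan n)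
    {ε : ℝ} {P : Set (Space n)} (hP : P ∈ pieces ε A B) :
    volume.real (ci (B ∪ P)) = volume.real B + volume.real P := by
  have hsub := piece_subset_diff hP
  rw [measureReal_congr (ci_ae_eq (volume_frontier_union_piece hA hB hP)), Set.union_comm,
    measureReal_union (Set.disjoint_left.2 fun p hp => (hsub hp).2)
      (RegularJordan.isClosed hB).measurableSet
      (ne_top_of_le_ne_top (RegularJordan.volume_ne_top hA)
        (measure_mono (hsub.trans Set.sdiff_subset)))
      (RegularJordan.volume_ne_top hB), add_comm]

theorem volume_frontier_inter (hA : A ∈ RegularJordan n) (hB : B ∈ RegularJordan n) :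
    volume (frontier (A ∩ B)) = 0 :=
  measure_mono_null (frontier_inter_subset A B) (measure_union_null
    (measure_mono_null Set.inter_subset_left hA.2.2)
    (measure_mono_null Set.inter_subset_right hB.2.2))

theorem ci_inter_mem (hA : A ∈ RegularJordan n) (hB : B ∈ RegularJordan n) :
    ci (A ∩ B) ∈ RegularJordan n :=
  ci_mem_regularJordan (hA.1.subset Set.inter_subset_left) (volume_frontier_inter hA hB)

/-- Up to null sets `R P` lies in `B ∪ P`, so the sets `R P \ B` are almost disjoint. Each has
measure `t μ(P)`, and the `μ(P)` sum to `μ(A \ B)`. -/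
theorem IsIntermediate.biUnion (hA : A ∈ RegularJordan n) (hB : B ∈ RegularJordan n)
    (hBA : B ⊂ A) {ε t : ℝ} (hε : 0 < ε) {R : Set (Space n) → Set (Space n)}
    (hR : ∀ P ∈ pieces ε A B, IsIntermediate t (ci (B ∪ P)) B (R P)) :
    IsIntermediate t A B (⋃ P ∈ pieces ε A B, R P) := by
  have hfin := finite_pieces hA hB hε
  have hmem : (⋃ P ∈ pieces ε A B, R P) ∈ RegularJordan n :=
    RegularJordan.biUnion hfin fun P hP => (hR P hP).mem
  have hsup : B ⊆ ⋃ P ∈ pieces ε A B, R P := by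
    -- Strict inclusion provides at least one piece; an empty union would not contain `B`.
    obtain ⟨p, hp⟩ := Set.nonempty_of_ssubset hBA
    rw [← sUnion_pieces ε A B] at hp
    obtain ⟨P, hP, -⟩ := hp
    exact (hR P hP).superset.trans (Set.subset_biUnion_of_mem hP)
  have hBm := (RegularJordan.isClosed hB).measurableSet
  have htop : ∀ P ∈ pieces ε A B, volume (R P) ≠ ⊤ := fun P hP =>
    RegularJordan.volume_ne_top (hR P hP).mem
  refine ⟨hmem, Set.iUnion₂_subset fun P hP => (hR P hP).subset.trans ?_, hsup, ?_⟩
  · exact RegularJordan.ci_subset hA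
      (Set.union_subset hBA.1 ((piece_subset_diff hP).trans Set.sdiff_subset))
  have hnull : ∀ P ∈ pieces ε A B, volume (ci (B ∪ P) \ (B ∪ P)) = 0 := fun P hP =>
    (ae_eq_set.1 (ci_ae_eq (volume_frontier_union_piece hA hB hP))).1
  have hdisj : (↑hfin.toFinset : Set (Set (Space n))).Pairwise
      (Function.onFun (AEDisjoint volume) fun P => R P \ B) := by
    intro P hP Q hQ hne
    rw [hfin.coe_toFinset] at hP hQ
    refine measure_mono_null ?_ (measure_union_null (hnull P hP) (hnull Q hQ))
    rintro p ⟨⟨hpP, hpB⟩, hpQ, -⟩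
    by_cases h1 : p ∈ B ∪ P
    · refine Or.inr ⟨(hR Q hQ).subset hpQ, ?_⟩
      rintro (h | h)
      · exact hpB h
      · exact Set.disjoint_left.1 (pieces_pairwiseDisjoint ε A B hP hQ hne)
          (h1.resolve_left hpB) h
    · exact Or.inl ⟨(hR P hP).subset hpP, h1⟩
  have hdiff : (⋃ P ∈ pieces ε A B, R P) \ B = ⋃ P ∈ hfin.toFinset, (R P \ B) := by
    simp only [Set.iUnion_sdiff, hfin.mem_toFinset]
  have h1 : volume.real ((⋃ P ∈ pieces ε A B, R P) \ B)
      = ∑ P ∈ hfin.toFinset, volume.real (R P \ B) := by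
    rw [hdiff]
    refine measureReal_biUnion_finset₀ hdisj (fun P hP => ?_) fun P hP => ?_
    · exact ((RegularJordan.isClosed
        (hR P (hfin.mem_toFinset.1 hP)).mem).measurableSet.diff hBm).nullMeasurableSet
    · exact ne_top_of_le_ne_top (htop P (hfin.mem_toFinset.1 hP))
        (measure_mono Set.sdiff_subset)
  have h2 : ∀ P ∈ hfin.toFinset, volume.real (R P \ B) = t * volume.real P := by
    intro P hP
    rw [hfin.mem_toFinset] at hP
    rw [measureReal_sdiff (hR P hP).superset hBm (htop P hP),
      (hR P hP).volume_eq, volume_ci_union_piece hA hB hP]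
    ring
  have h3 : volume.real (A \ B) = ∑ P ∈ hfin.toFinset, volume.real P := by
    rw [← sUnion_pieces ε A B, Set.sUnion_eq_biUnion]
    have := measureReal_biUnion_finset₀ (μ := volume) (s := hfin.toFinset)
      (f := fun P : Set (Space n) => P) ?_ (fun P hP => ?_) fun P hP => ?_
    · simpa only [hfin.mem_toFinset] using this
    · intro P hP Q hQ hne
      rw [hfin.coe_toFinset] at hP hQ
      exact (pieces_pairwiseDisjoint ε A B hP hQ hne).aedisjoint
    · exact nullMeasurableSet_of_null_frontier
        (volume_frontier_of_mem_pieces hA hB (hfin.mem_toFinset.1 hP))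
    · exact ne_top_of_le_ne_top (RegularJordan.volume_ne_top hA) (measure_mono
        ((piece_subset_diff (hfin.mem_toFinset.1 hP)).trans Set.sdiff_subset))
  rw [Finset.sum_congr rfl h2, ← Finset.mul_sum, ← h3,
    measureReal_sdiff hsup hBm (RegularJordan.volume_ne_top hmem),
    measureReal_sdiff hBA.1 hBm (RegularJordan.volume_ne_top hA)] at h1
  linarith

variable [NeZero n]

theorem IsNestedAverage.isIntermediate (hA : A ∈ RegularJordan n) (hB : B ∈ RegularJordan n)
    {N ε t : ℝ} (hN : 1 ≤ N) (hε : 0 < ε) (ht : t ∈ Set.Icc (0 : ℝ) 1) {M : Set (Space n)}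
    (h : IsNestedAverage N ε t A B M) : IsIntermediate t A B M := by
  obtain ⟨rfl, rfl⟩ | ⟨hBA, R, hR, rfl⟩ := h
  · exact ⟨hA, subset_rfl, subset_rfl, by ring⟩
  · exact IsIntermediate.biUnion hA hB hBA hε fun P hP =>
      (hR P hP).isIntermediate (ci_union_piece_mem hA hB hP) (subset_ci_union_piece hB P) hB hN ht

theorem IsNestedAverage.exists_of_subset (hA : A ∈ RegularJordan n) (hB : B ∈ RegularJordan n)
    (hBA : B ⊆ A) {N ε t : ℝ} (hN : 1 ≤ N) (hε : 0 < ε) (ht : t ∈ Set.Icc (0 : ℝ) 1) :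
    ∃ M, IsNestedAverage N ε t A B M := by
  rcases hBA.eq_or_ssubset with rfl | hss
  · exact ⟨B, Or.inl ⟨rfl, rfl⟩⟩
  have hex : ∀ P : Set (Space n), ∃ M, P ∈ pieces ε A B →
      IsSimpleAverage N t (ci (B ∪ P)) B M := by
    intro P
    by_cases hP : P ∈ pieces ε A B
    -- A center point exists only for a nonempty set; for empty `B` this requires `P` to have
    -- interior.
    · have hne : (ci (B ∪ P)).Nonempty :=
        ((nonempty_interior_of_mem_pieces hA hB hε hP).mono
          (interior_mono Set.subset_union_right)).closure
      obtain ⟨M, hM⟩ := IsSimpleAverage.exists_of_subset (ci_union_piece_mem hA hB hP) hne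
        (subset_ci_union_piece hB P) hB hN ht
      exact ⟨M, fun _ => hM⟩
    · exact ⟨∅, fun h => absurd h hP⟩
  choose R hR using hex
  exact ⟨_, Or.inr ⟨hss, R, hR, rfl⟩⟩

/-! ### Averages of general sets and binary schemes. -/

theorem exists_isMeasureAverage (hA : A ∈ RegularJordan n) (hB : B ∈ RegularJordan n)
    {N ε t : ℝ} (hN : 1 ≤ N) (hε : 0 < ε) (ht : t ∈ Set.Icc (0 : ℝ) 1) :
    ∃ M, IsMeasureAverage N ε t A B M := by
  have hD := ci_inter_mem hA hB
  obtain ⟨R₁, h₁⟩ := IsNestedAverage.exists_of_subset hA hD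
    (RegularJordan.ci_subset hA Set.inter_subset_left) hN hε ht
  obtain ⟨R₂, h₂⟩ := IsNestedAverage.exists_of_subset hB hD
    (RegularJordan.ci_subset hB Set.inter_subset_right) hN hε (t := 1 - t)
    ⟨by linarith [ht.2], by linarith [ht.1]⟩
  exact ⟨_, R₁, R₂, h₁, h₂, rfl⟩

/-- Since `D ⊆ R₁ ∩ R₂ ⊆ A ∩ B` and `D` is almost all of `A ∩ B`, the overlap has measure `μ(D)`. By
inclusion-exclusion the weights `1 - t` and `t` of `μ(D)` cancel against it. -/
theorem IsMeasureAverage.spec (hA : A ∈ RegularJordan n) (hB : B ∈ RegularJordan n)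
    {N ε t : ℝ} (hN : 1 ≤ N) (hε : 0 < ε) (ht : t ∈ Set.Icc (0 : ℝ) 1) {M : Set (Space n)}
    (h : IsMeasureAverage N ε t A B M) :
    M ∈ RegularJordan n ∧
      volume.real M = t * volume.real A + (1 - t) * volume.real B := by
  obtain ⟨R₁, R₂, h₁, h₂, rfl⟩ := h
  have hD := ci_inter_mem hA hB
  have i₁ := h₁.isIntermediate hA hD hN hε ht
  have i₂ := h₂.isIntermediate hB hD hN hε ⟨by linarith [ht.2], by linarith [ht.1]⟩
  refine ⟨RegularJordan.union i₁.mem i₂.mem, ?_⟩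
  have hinter : volume.real (R₁ ∩ R₂) = volume.real (ci (A ∩ B)) := by
    refine le_antisymm ?_ (measureReal_mono (Set.subset_inter i₁.superset i₂.superset)
      (ne_top_of_le_ne_top (RegularJordan.volume_ne_top i₁.mem)
        (measure_mono Set.inter_subset_left)))
    rw [measureReal_congr (ci_ae_eq (volume_frontier_inter hA hB))]
    exact measureReal_mono (Set.inter_subset_inter i₁.subset i₂.subset)
      (ne_top_of_le_ne_top (RegularJordan.volume_ne_top hA) (measure_mono Set.inter_subset_left))
  have hadd := measureReal_union_add_inter (μ := volume) (s := R₁)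
    (RegularJordan.isClosed i₂.mem).measurableSet (RegularJordan.volume_ne_top i₁.mem)
    (RegularJordan.volume_ne_top i₂.mem)
  rw [hinter, i₁.volume_eq, i₂.volume_eq] at hadd
  linarith

/-- Existence and properties are proved together, since an average exists only once its operands are
known to be regular Jordan sets. -/
theorem BinaryScheme.exists_onSets (T : BinaryScheme) {N ε : ℝ} (hN : 1 ≤ N) (hε : 0 < ε)
    {F : ℤ → Set (Space n)} (hF : ∀ i, F i ∈ RegularJordan n) :
    (∃ M, T.OnSets N ε F M) ∧ ∀ M, T.OnSets N ε F M →
      M ∈ RegularJordan n ∧ volume.real M = T.onReals fun i => volume.real (F i) := by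
  induction T with
  | term i =>
    refine ⟨⟨F i, rfl⟩, ?_⟩
    rintro M rfl
    exact ⟨hF i, rfl⟩
  | average t l r ihl ihr =>
    refine ⟨?_, ?_⟩
    · obtain ⟨A, hA⟩ := ihl.1
      obtain ⟨B, hB⟩ := ihr.1
      obtain ⟨M, hM⟩ := exists_isMeasureAverage (ihl.2 A hA).1 (ihr.2 B hB).1 hN hε t.2
      exact ⟨M, A, B, hA, hB, hM⟩
    · rintro M ⟨A, B, hA, hB, hM⟩
      obtain ⟨hA', hAv⟩ := ihl.2 A hA
      obtain ⟨hB', hBv⟩ := ihr.2 B hB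
      obtain ⟨hM', hMv⟩ := hM.spec hA' hB' hN hε t.2
      refine ⟨hM', ?_⟩
      rw [hMv, hAv, hBv, onReals]

end

end SetAverage

theorem corollary5p4 (n : ℕ) (hn : 1 ≤ n) (N ε : ℝ) (hN : 1 ≤ N) (hε : 0 < ε)
    (a : ℤ → ℝ) (ha : SetAverage.IsAveragingRule a)
    (T : SetAverage.BinaryScheme) (hT : T.Represents a)
    (F : ℤ → Set (SetAverage.Space n)) (hF : ∀ i, F i ∈ SetAverage.RegularJordan n) :
    (∃ M, T.OnSets N ε F M) ∧
    ∀ M, T.OnSets N ε F M →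
      M ∈ SetAverage.RegularJordan n ∧
      HasSum (fun i => a i * MeasureTheory.volume.real (F i)) (MeasureTheory.volume.real M) := by
  -- Positive dimension ensures that bounded sets have nonempty complement and points are null.
  have : NeZero n := ⟨by omega⟩
  obtain ⟨h1, h2⟩ := T.exists_onSets hN hε hF
  refine ⟨h1, fun M hM => ⟨(h2 M hM).1, ?_⟩⟩
  rw [(h2 M hM).2]
  exact hT _
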